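/- Let $G$ be a finite extensive-form game with perfect information: a finite rooted tree with set $Z$ of terminal nodes, a finite set $I$ of players, an assignment of a player to each non-terminal node, and payoff functions $f_j\colon Z\to\mathbb{R}$, $j\in I$. A move of a player at one of her nodes is an immediate successor of that node. A (behavioral) strategy of player $j$ assigns to each node of $j$ a probability distribution over her moves there. In the infinitely repeated game with stage game $G$, a super strategy of player $j$ assigns to each finite history $h\in Z^t$, $t\ge 0$, a strategy of $j$ in $G$, to be played in round $t+1$; a profile of super strategies induces a probability distribution over the infinite histories in $Z^{\mathbb{N}}$. Fix a player $i$ and write $f=f_i$. A valuation of $i$ is a real-valued function on the set of all moves of $i$. Let $v$ be an initial valuation. *Averaging revision.* After the history $h=(z_1,\dots,z_t)$ the valuation is $v^h$, where, for a move $m$ of $i$, $v^h(m)=v(m)$ if the node $m$ was never reached in $h$, and otherwise $v^h(m)=\frac1k\sum_{l=1}^k f(z_{t_l})$, where $t_1,\dots,t_k$ are the rounds in which $m$ was reached (that is, $m$ is on the path from the root to $z_{t_l}$). *$\delta$-exploratory myopic strategy.* For a valuation $w$ and $0\le\delta\le 1$, the strategy $\sigma^w_\delta$ selects at each node $n$ of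 $i$ a move according to $(1-\delta)\sigma^w(n)+\delta\mu(n)$, where $\sigma^w(n)$ is the uniform distribution over the maximizers of $w$ among the moves at $n$, and $\mu(n)$ is the uniform distribution over all the moves at $n$. Let $\rho$ be the individually rational (maxmin) payoff of $i$ in $G$: the maximum, over the strategies of $i$, of the minimum, over the strategies of the other players, of $i$'s expected payoff. Then for every $\varepsilon>0$ there is $\delta_0>0$, depending only on $G$, $i$ and $\varepsilon$, such that for every $\delta\in[0,1]$ with $0<\delta<\delta_0$, for every initial valuation $v$ and every profile $\Sigma$ of super strategies in which $i$'s super strategy is $\Sigma_i(h)=\sigma^{v^h}_\delta$ (the super strategies of the other players are arbitrary), for almost all infinite histories $(z_1,z_2,\dots)$ with respect to the distribution induced by $\Sigma$, $$\liminf_{t\to\infty}\ \frac1t\sum_{l=1}^t f(z_l)>\rho-\varepsilon .$$ -/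

import Mathlib

open MeasureTheory ProbabilityTheory Filter

/-- A game with complete (and perfect) information in extensive form, with set of players `I`,
played on a rooted tree with set of nodes `V`. The three last fields say that the directed graph
`Arc` is a tree with root `root`, in which the arcs lead away from the root. -/
structure ExtensiveGame (I V : Type*) where
  /-- The root of the tree. -/
  root : V
  /-- `Arc n m`: the node `m` is an immediate successor of the node `n`. -/
  Arc : V → V → Prop
  /-- The player whose turn it is to play at a given non-terminal node. -/
  turn : {n : V // ∃ m, Arc n m} → I
  /-- The payoff of each player at each terminal node. -/
  payoff : I → {z : V // ∀ m, ¬ Arc z m} → ℝ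
  not_arc_root : ∀ n, ¬ Arc n root
  eq_of_arc : ∀ {n n' m}, Arc n m → Arc n' m → n = n'
  reach_root : ∀ n, Relation.ReflTransGen Arc root n

namespace ExtensiveGame

noncomputable section

variable {I V : Type*} (G : ExtensiveGame I V)

/-- Non-terminal nodes. -/
abbrev Decision : Type _ := {n : V // ∃ m, G.Arc n m}

/-- Terminal nodes. -/
def Terminal : Type _ := {z : V // ∀ m, ¬ G.Arc z m}

/-- The nodes in which it is the turn of player `i`. -/
abbrev DecisionOf (i : I) : Type _ := {n : G.Decision // G.turn n = i}

/-- The moves available at a node. -/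
abbrev MovesAt (n : V) : Type _ := {m : V // G.Arc n m}

/-- All the moves of player `i`. -/
abbrev MovesOf (i : I) : Type _ := {m : V // ∃ n : G.DecisionOf i, G.Arc n.1.1 m}

/-- The node `n` is on the path that leads from the root to `m`. -/
def Reaches (n m : V) : Prop := Relation.ReflTransGen G.Arc n m

instance [Finite V] : Finite G.Terminal :=
  inferInstanceAs (Finite {z : V // ∀ m, ¬ G.Arc z m})

instance [Finite V] : Fintype G.Terminal := Fintype.ofFinite _

instance : MeasurableSpace G.Terminal := ⊤

instance : DiscreteMeasurableSpace G.Terminal := ⟨fun _ => trivial⟩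

instance [Finite V] (n : V) : Fintype (G.MovesAt n) := Fintype.ofFinite _

instance (i : I) (n : G.DecisionOf i) : Nonempty (G.MovesAt n.1.1) :=
  let ⟨m, hm⟩ := n.1.2
  ⟨⟨m, hm⟩⟩

/-! ### Strategies and the outcome of the stage game -/

/-- Behavioral strategies of player `i` in the stage game. -/
abbrev Strategy (i : I) : Type _ := (n : G.DecisionOf i) → PMF (G.MovesAt n.1.1)

/-- Profiles of behavioral strategies. -/
abbrev Profile : Type _ := (i : I) → G.Strategy i

theorem not_transGen_self (n : V) : ¬ Relation.TransGen G.Arc n n := by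
  induction G.reach_root n with
  | refl =>
    intro h
    obtain ⟨b, -, hb⟩ := Relation.TransGen.tail'_iff.1 h
    exact G.not_arc_root b hb
  | @tail v w _ hvw ih =>
    intro h
    obtain ⟨b, hb, hbw⟩ := Relation.TransGen.tail'_iff.1 h
    obtain rfl := G.eq_of_arc hbw hvw
    exact ih (Relation.TransGen.head' hvw hb)

theorem wellFounded_swap_arc [Finite V] : WellFounded (fun m n => G.Arc n m) := by
  have hT : WellFounded (fun m n => Relation.TransGen G.Arc n m) :=
    @Finite.wellFounded_of_trans_of_irrefl V _ _
      ⟨fun _ _ _ h₁ h₂ => h₂.trans h₁⟩ ⟨G.not_transGen_self⟩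
  exact Subrelation.wf (fun h => Relation.TransGen.single h) hT

open scoped Classical in
/-- The distribution of the terminal node reached when the strategy profile `σ` is played
starting at the node `n`. -/
def outcomeFrom [Finite V] (σ : G.Profile) : V → PMF G.Terminal :=
  G.wellFounded_swap_arc.fix fun n next =>
    if h : ∃ m, G.Arc n m then
      (σ (G.turn ⟨n, h⟩) ⟨⟨n, h⟩, rfl⟩).bind fun m => next m.1 m.2
    else PMF.pure ⟨n, fun m hm => h ⟨m, hm⟩⟩

/-- The distribution of the terminal node reached in the game when `σ` is played. -/
def outcome [Finite V] (σ : G.Profile) : PMF G.Terminal := G.outcomeFrom σ G.root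

/-- The expected payoff of player `i` when `σ` is played. -/
def expectedPayoff [Finite V] (i : I) (σ : G.Profile) : ℝ :=
  ∑ z : G.Terminal, (G.outcome σ z).toReal * G.payoff i z

open scoped Classical in
/-- The individually rational (maxmin) payoff of player `i`: the supremum over the strategies `s`
of `i` of the infimum, over the strategies of the other players, of the expected payoff of `i`.
(The component `τ i` of the profile `τ` is overwritten by `s`, hence irrelevant.) -/
def maxmin [Finite V] (i : I) : ℝ :=
  ⨆ s : G.Strategy i, ⨅ τ : G.Profile, G.expectedPayoff i (Function.update τ i s)

/-! ### The infinitely repeated game -/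

/-- Finite histories of `t` rounds. -/
abbrev History (t : ℕ) : Type _ := Fin t → G.Terminal

/-- Super strategies of player `i`: after each finite history of `t` rounds, a strategy in the
stage game, to be played in round `t + 1`. -/
abbrev SuperStrategy (i : I) : Type _ := (t : ℕ) → G.History t → G.Strategy i

/-- Profiles of super strategies. -/
abbrev SuperProfile : Type _ := (i : I) → G.SuperStrategy i

/-- The distribution of the terminal node reached in round `t + 1`, given the history `h` of the
first `t` rounds. -/
def roundOutcome [Finite V] (S : G.SuperProfile) (t : ℕ) (h : G.History t) : PMF G.Terminal :=
  G.outcome fun i => S i t h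

/-- The transition kernels of the play. Coordinate `k` of a sequence of terminal nodes is the
terminal node reached in round `k + 1`. -/
def playKernel [Finite V] (S : G.SuperProfile) (n : ℕ) :
    Kernel ((_ : Finset.Iic n) → G.Terminal) G.Terminal :=
  Kernel.ofFunOfCountable fun h =>
    (G.roundOutcome S (n + 1) fun k =>
      h ⟨k.1, Finset.mem_Iic.2 (Nat.lt_succ_iff.1 k.2)⟩).toMeasure

instance [Finite V] (S : G.SuperProfile) (n : ℕ) : IsMarkovKernel (G.playKernel S n) :=
  ⟨fun _ => PMF.toMeasure.isProbabilityMeasure _⟩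

/-- The probability distribution on infinite histories induced by a profile of super strategies;
`h k` is the terminal node reached in round `k + 1` of the history `h`. -/
def playMeasure [Finite V] (S : G.SuperProfile) : Measure (ℕ → G.Terminal) :=
  Kernel.trajMeasure (X := fun _ => G.Terminal)
    (G.roundOutcome S 0 Fin.elim0).toMeasure (G.playKernel S)

/-! ### Learning by valuation -/

/-- Valuations of player `i`. -/
abbrev Valuation (i : I) : Type _ := G.MovesOf i → ℝ

/-- Strategy rules of player `i`. -/
abbrev StrategyRule (i : I) : Type _ := G.Valuation i → G.Strategy i

/-- Revision rules of player `i`. -/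
structure RevisionRule (i : I) where
  /-- The valuation after a finite history, for a given initial valuation. -/
  revise : G.Valuation i → (t : ℕ) → G.History t → G.Valuation i
  revise_empty : ∀ v (h : G.History 0), revise v 0 h = v

/-- The valuation super strategy induced by a strategy rule, a revision rule and an initial
valuation. -/
def valuationSuperStrategy {i : I} (σ : G.StrategyRule i) (R : G.RevisionRule i)
    (v : G.Valuation i) : G.SuperStrategy i :=
  fun t h => σ (R.revise v t h)

variable {G} in
/-- The value of a move of player `i` at the node `n` under a valuation. -/
def Valuation.at {i : I} (v : G.Valuation i) (n : G.DecisionOf i) (m : G.MovesAt n.1.1) : ℝ :=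
  v ⟨m.1, n, m.2⟩

open scoped Classical in
/-- The maximizers of a valuation among the moves at a node. -/
def maximizers [Finite V] {i : I} (v : G.Valuation i) (n : G.DecisionOf i) :
    Finset (G.MovesAt n.1.1) :=
  {m | ∀ m', v.at n m' ≤ v.at n m}

theorem maximizers_nonempty [Finite V] {i : I} (v : G.Valuation i) (n : G.DecisionOf i) :
    (G.maximizers v n).Nonempty := by
  obtain ⟨m, hm⟩ := Finite.exists_max (v.at n)
  exact ⟨m, by simpa [maximizers] using hm⟩

/-- The myopic strategy rule: at each node, the uniform distribution over the moves of highest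
valuation. -/
def myopic [Finite V] (i : I) : G.StrategyRule i :=
  fun v n => PMF.uniformOfFinset (G.maximizers v n) (G.maximizers_nonempty v n)

/-- The strategy that selects at each node one of the moves uniformly. -/
def uniformStrategy [Finite V] (i : I) : G.Strategy i :=
  fun n => PMF.uniformOfFintype (G.MovesAt n.1.1)

/-- The mixture `(1 - δ) p + δ q` of two probability distributions. -/
def mix {α : Type*} (δ : unitInterval) (p q : PMF α) : PMF α :=
  ⟨fun a => ENNReal.ofReal (1 - δ) * p a + ENNReal.ofReal δ * q a, by
    have h : ENNReal.ofReal (1 - δ) * 1 + ENNReal.ofReal δ * 1 = 1 := by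
      rw [mul_one, mul_one, ← ENNReal.ofReal_add (sub_nonneg.2 δ.2.2) δ.2.1]
      simp
    have hs := (ENNReal.summable.hasSum :
      HasSum (fun a => ENNReal.ofReal (1 - δ) * p a + ENNReal.ofReal δ * q a) _)
    rwa [ENNReal.tsum_add, ENNReal.tsum_mul_left, ENNReal.tsum_mul_left, p.tsum_coe, q.tsum_coe,
      h] at hs⟩

/-- The `δ`-exploratory myopic strategy rule. -/
def exploratory [Finite V] (i : I) (δ : unitInterval) : G.StrategyRule i :=
  fun v n => mix δ (G.myopic i v n) (G.uniformStrategy i n)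

open scoped Classical in
/-- The rounds of a finite history in which the node `m` is reached. -/
def reachTimes {t : ℕ} (h : G.History t) (m : V) : Finset (Fin t) := {l | G.Reaches m (h l).1}

open scoped Classical in
/-- The averaging revision rule: the valuation of a move that was already made is the average of
the payoffs in the rounds in which it was made; the valuation of other moves is unchanged. -/
def averaging (i : I) : G.RevisionRule i where
  revise v _ h m :=
    if G.reachTimes h m.1 = ∅ then v m
    else (∑ l ∈ G.reachTimes h m.1, G.payoff i (h l)) / ((G.reachTimes h m.1).card : ℝ)
  revise_empty v h := by
    funext m
    exact if_pos (Finset.eq_empty_of_isEmpty _)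

end

end ExtensiveGame

/-! Let `value` be the backward-induction value of a node when all other players act against $i$.
The opponents can hold $i$ down to the value of the root, so $\rho$ is at most that value
(`maxmin_le_value_root`). It is then enough to show, for each node $n$, that almost surely the total
payoff over the rounds visiting $n$ is at least (value of $n$ minus $c\delta$) times the number of
visits, up to an error bounded in time; $c$ depends only on the game, $i$ and $n$. This is
`exists_ae_exists_le_visitTotal`, and at the root, visited in every round, it gives the theorem.

The induction climbs from the leaves. At an opponent's node every successor is worth at least as
much as the node, so the bounds of the successors add up. At a node of $i$, exploration gives a best
move $m_0$ a positive share of the visits, so the bounded error at $m_0$ stays bounded when rescaled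
to the visits of another move. Any other move is chosen greedily only when its average is at least
that of $m_0$, hence inherits the bound (`exists_le_visitTotal_of_greedy`). Non-greedy choices occur
at rate at most $2\delta$ and cost at most $2K$ each, where $K$ bounds the payoffs.

The opponents may react to the whole history, so rounds are not independent. Both frequency
statements come instead from exponential supermartingales and a maximal inequality
(`ae_exists_sum_le`). The errors are bounded rather than $o(t)$, so the argument also covers nodes
visited rarely or finitely often. -/

namespace ExtensiveGame

open scoped ENNReal Topology

noncomputable section

variable {I V : Type*} (G : ExtensiveGame I V)

/-! ### Exponential supermartingales along the play -/

section Play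

variable {G} in
/-- The history of the first `t` rounds of an infinite history. -/
def initialHistory (x : ℕ → G.Terminal) (t : ℕ) : G.History t := fun k => x k

theorem measurable_initialHistory (t : ℕ) :
    Measurable fun x : ℕ → G.Terminal => initialHistory x t :=
  measurable_pi_lambda _ fun k => measurable_pi_apply (k : ℕ)

/-- The process with multiplicative increments `F`, stopped when it reaches `a`. -/
def stoppedProd (F : (t : ℕ) → G.History t → G.Terminal → ℝ≥0∞) (a : ℝ≥0∞) :
    (t : ℕ) → G.History t → ℝ≥0∞
  | 0, _ => 1
  | t + 1, h =>
    stoppedProd F a t (fun k => h k.castSucc) *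
      open scoped Classical in
      if a ≤ stoppedProd F a t (fun k => h k.castSucc) then 1
      else F t (fun k => h k.castSucc) (h (Fin.last t))

theorem stoppedProd_succ (F : (t : ℕ) → G.History t → G.Terminal → ℝ≥0∞) (a : ℝ≥0∞)
    (x : ℕ → G.Terminal) (t : ℕ) [Decidable (a ≤ G.stoppedProd F a t (initialHistory x t))] :
    G.stoppedProd F a (t + 1) (initialHistory x (t + 1)) =
      G.stoppedProd F a t (initialHistory x t) *
        if a ≤ G.stoppedProd F a t (initialHistory x t) then 1
        else F t (initialHistory x t) (x t) := by
  rw [stoppedProd]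
  congr

theorem le_stoppedProd_of_le_prod (F : (t : ℕ) → G.History t → G.Terminal → ℝ≥0∞) (a : ℝ≥0∞)
    (x : ℕ → G.Terminal) (t : ℕ) :
    a ≤ G.stoppedProd F a t (initialHistory x t) ∨
      G.stoppedProd F a t (initialHistory x t) =
        ∏ k ∈ Finset.range t, F k (initialHistory x k) (x k) := by
  classical
  induction t with
  | zero => exact Or.inr (by simp [stoppedProd])
  | succ t ih =>
    rw [stoppedProd_succ]
    by_cases h : a ≤ G.stoppedProd F a t (initialHistory x t)
    · left
      rwa [if_pos h, mul_one]
    · right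
      rw [if_neg h, Finset.prod_range_succ, ih.resolve_left h]

/-- Stopping makes a crossing of the level permanent. The probability of ever crossing is therefore
the supremum of the probabilities at fixed times. -/
theorem monotone_le_stoppedProd (F : (t : ℕ) → G.History t → G.Terminal → ℝ≥0∞) (a : ℝ≥0∞) :
    Monotone fun t => {x | a ≤ G.stoppedProd F a t (initialHistory x t)} := by
  classical
  refine monotone_nat_of_le_succ fun t x hx => ?_
  simp only [Set.mem_ofPred_eq] at hx ⊢
  rwa [stoppedProd_succ, if_pos hx, mul_one]

variable [Finite V]

instance (S : G.SuperProfile) : IsProbabilityMeasure (G.playMeasure S) := by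
  unfold playMeasure; infer_instance

theorem lintegral_toMeasure (p : PMF G.Terminal) (F : G.Terminal → ℝ≥0∞) :
    ∫⁻ z, F z ∂p.toMeasure = ∑ z, p z * F z := by
  rw [lintegral_fintype]
  refine Finset.sum_congr rfl fun z _ => ?_
  rw [PMF.toMeasure_apply_singleton _ _ (measurableSet_singleton z), mul_comm]

theorem map_eval_zero_playMeasure (S : G.SuperProfile) :
    (G.playMeasure S).map (fun x => x 0) = (G.roundOutcome S 0 Fin.elim0).toMeasure := by
  have h : (fun x : ℕ → G.Terminal => x 0) =
      (fun y : (_ : Finset.Iic 0) → G.Terminal => y ⟨0, by simp⟩) ∘ Preorder.frestrictLe 0 := rfl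
  rw [h, ← Measure.map_map (by fun_prop) (by fun_prop), playMeasure, Kernel.trajMeasure,
    Measure.map_comp _ _ (by fun_prop), Kernel.traj_map_frestrictLe, Kernel.partialTraj_self,
    Measure.id_comp, Measure.map_map (by fun_prop) (by fun_prop)]
  convert! Measure.map_id

/-- The one-step supermartingale inequality: condition on the first `t` rounds and integrate the
next one. The first round is drawn from the initial measure and the later ones from the kernels,
hence the two cases. -/
theorem lintegral_mul_le_of_sum_le_one (S : G.SuperProfile) (t : ℕ) (Φ : G.History t → ℝ≥0∞)
    (F : G.History t → G.Terminal → ℝ≥0∞)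
    (hF : ∀ h, ∑ z, G.roundOutcome S t h z * F h z ≤ 1) :
    ∫⁻ x, Φ (initialHistory x t) * F (initialHistory x t) (x t) ∂(G.playMeasure S) ≤
      ∫⁻ x, Φ (initialHistory x t) ∂(G.playMeasure S) := by
  cases t with
  | zero =>
    have h0 : ∀ x : ℕ → G.Terminal, initialHistory x 0 = Fin.elim0 :=
      fun x => Subsingleton.elim _ _
    simp only [h0]
    have hm : Measurable fun x : ℕ → G.Terminal => F Fin.elim0 (x 0) :=
      (Measurable.of_discrete (f := F Fin.elim0)).comp (measurable_pi_apply 0)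
    rw [lintegral_const, measure_univ, mul_one, lintegral_const_mul _ hm,
      ← lintegral_map (f := F Fin.elim0) (g := fun x : ℕ → G.Terminal => x 0)
        Measurable.of_discrete (measurable_pi_apply 0),
      map_eval_zero_playMeasure, lintegral_toMeasure]
    exact mul_le_of_le_one_right zero_le (hF _)
  | succ n =>
    let e : ((_ : Finset.Iic n) → G.Terminal) → G.History (n + 1) := fun y k =>
      y ⟨k.1, Finset.mem_Iic.2 (Nat.lt_succ_iff.1 k.2)⟩
    have he : ∀ x : ℕ → G.Terminal, initialHistory x (n + 1) = e (Preorder.frestrictLe n x) :=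
      fun x => rfl
    simp only [he]
    have hm := Kernel.map_frestrictLe_trajMeasure_compProd_eq_map_trajMeasure
      (X := fun _ => G.Terminal) (κ := G.playKernel S)
      (μ₀ := (G.roundOutcome S 0 Fin.elim0).toMeasure) (a := n)
    have hd : Measurable fun y : ((_ : Finset.Iic n) → G.Terminal) × G.Terminal =>
        Φ (e y.1) * F (e y.1) y.2 := Measurable.of_discrete
    have hd' : Measurable fun y : ((_ : Finset.Iic n) → G.Terminal) => Φ (e y) :=
      Measurable.of_discrete
    have h1 := lintegral_map (μ := G.playMeasure S) hd
      (g := fun x => (Preorder.frestrictLe n x, x (n + 1))) (by fun_prop)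
    have h2 := lintegral_map (μ := G.playMeasure S) hd'
      (g := Preorder.frestrictLe n) (by fun_prop)
    refine h1.symm.trans_le (le_trans ?_ h2.le)
    rw [playMeasure, ← hm, Measure.lintegral_compProd hd]
    refine lintegral_mono fun y => ?_
    change ∫⁻ b, Φ (e y) * F (e y) b ∂_ ≤ Φ (e y)
    rw [lintegral_const_mul _ (Measurable.of_discrete (f := F (e y)))]
    refine mul_le_of_le_one_right zero_le ?_
    have : G.playKernel S n y = (G.roundOutcome S (n + 1) (e y)).toMeasure := rfl
    rw [this, lintegral_toMeasure]
    exact hF _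

theorem lintegral_stoppedProd_le_one (S : G.SuperProfile)
    (F : (t : ℕ) → G.History t → G.Terminal → ℝ≥0∞)
    (hF : ∀ t h, ∑ z, G.roundOutcome S t h z * F t h z ≤ 1) (a : ℝ≥0∞) (t : ℕ) :
    ∫⁻ x, G.stoppedProd F a t (initialHistory x t) ∂(G.playMeasure S) ≤ 1 := by
  classical
  induction t with
  | zero => simp [stoppedProd]
  | succ t ih =>
    simp only [stoppedProd_succ]
    refine le_trans ?_ ih
    refine G.lintegral_mul_le_of_sum_le_one S t (G.stoppedProd F a t)
      (fun h z => if a ≤ G.stoppedProd F a t h then 1 else F t h z) fun h => ?_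
    split_ifs
    · simp only [mul_one]
      rw [← tsum_fintype (L := .unconditional _), PMF.tsum_coe]
    · exact hF t h

/-- Ville's maximal inequality: Markov's inequality for the stopped process at each fixed time,
whose mean is at most one. -/
theorem measure_exists_le_prod_le (S : G.SuperProfile)
    (F : (t : ℕ) → G.History t → G.Terminal → ℝ≥0∞)
    (hF : ∀ t h, ∑ z, G.roundOutcome S t h z * F t h z ≤ 1) {a : ℝ≥0∞} (ha : a ≠ 0)
    (ha' : a ≠ ∞) :
    G.playMeasure S {x | ∃ t, a ≤ ∏ k ∈ Finset.range t, F k (initialHistory x k) (x k)} ≤ a⁻¹ := by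
  have hsub : {x | ∃ t, a ≤ ∏ k ∈ Finset.range t, F k (initialHistory x k) (x k)} ⊆
      ⋃ t, {x | a ≤ G.stoppedProd F a t (initialHistory x t)} := by
    rintro x ⟨t, ht⟩
    refine Set.mem_iUnion.2 ⟨t, ?_⟩
    rcases G.le_stoppedProd_of_le_prod F a x t with h | h
    · exact h
    · exact ht.trans h.ge
  refine (measure_mono hsub).trans ?_
  rw [(G.monotone_le_stoppedProd F a).measure_iUnion]
  refine iSup_le fun t => ?_
  refine (meas_ge_le_lintegral_div ?_ ha ha').trans ?_
  · exact ((Measurable.of_discrete (f := G.stoppedProd F a t)).comp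
      (G.measurable_initialHistory t)).aemeasurable
  · rw [← one_div]
    exact ENNReal.div_le_div_right (G.lintegral_stoppedProd_le_one S F hF a t) _

/-- If the exponentials of the increments `g` have conditional expectation at most one, then the
partial sums of the increments are almost surely bounded above. -/
theorem ae_exists_sum_le (S : G.SuperProfile) (g : (t : ℕ) → G.History t → G.Terminal → ℝ)
    (hg : ∀ t h, ∑ z, G.roundOutcome S t h z * ENNReal.ofReal (Real.exp (g t h z)) ≤ 1) :
    ∀ᵐ x ∂(G.playMeasure S), ∃ C : ℝ, ∀ t,
      ∑ k ∈ Finset.range t, g k (initialHistory x k) (x k) ≤ C := by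
  -- Unbounded partial sums exceed every `n`, so the product of exponentials reaches $e^n$, which
  -- has probability at most $e^{-n}$.
  have hbad : ∀ n : ℕ, G.playMeasure S {x | ¬ ∃ C : ℝ, ∀ t,
      ∑ k ∈ Finset.range t, g k (initialHistory x k) (x k) ≤ C} ≤
        (ENNReal.ofReal (Real.exp n))⁻¹ := by
    intro n
    refine le_trans (measure_mono ?_) (G.measure_exists_le_prod_le S
      (fun t h z => ENNReal.ofReal (Real.exp (g t h z))) hg
      (by simp [Real.exp_pos]) ENNReal.ofReal_ne_top)
    intro x hx
    simp only [Set.mem_ofPred_eq, not_exists, not_forall, not_le] at hx ⊢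
    obtain ⟨t, ht⟩ := hx n
    refine ⟨t, ?_⟩
    rw [← ENNReal.ofReal_prod_of_nonneg fun _ _ => (Real.exp_pos _).le, ← Real.exp_sum]
    exact ENNReal.ofReal_le_ofReal (Real.exp_le_exp.2 ht.le)
  rw [ae_iff]
  have hlim : Tendsto (fun n : ℕ => (ENNReal.ofReal (Real.exp n))⁻¹) atTop (𝓝 0) := by
    rw [← ENNReal.inv_top]
    exact (ENNReal.tendsto_ofReal_atTop.comp
      (Real.tendsto_exp_atTop.comp tendsto_natCast_atTop_atTop)).inv
  exact le_antisymm (ge_of_tendsto' hlim hbad) zero_le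

end Play

/-! ### The tree -/

section Tree

variable {G}

/-- The ancestors of `z` form a chain, so the two moves are comparable. If one lay strictly below
the other, its unique predecessor `n` would be its own descendant. -/
theorem eq_of_reaches_of_arc {n m m' z : V} (hm : G.Arc n m) (hm' : G.Arc n m')
    (h : G.Reaches m z) (h' : G.Reaches m' z) : m = m' := by
  have key : ∀ {a b : V}, G.Arc n a → G.Arc n b → G.Reaches a b → a = b := by
    intro a b ha hb hab
    rcases Relation.ReflTransGen.cases_tail hab with rfl | ⟨c, hac, hcb⟩
    · rfl
    · obtain rfl := G.eq_of_arc hcb hb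
      exact absurd (Relation.TransGen.head' ha hac) (G.not_transGen_self _)
  have hu : Relator.RightUnique (Function.swap G.Arc) := fun _ _ _ h₁ h₂ => G.eq_of_arc h₁ h₂
  rcases Relation.ReflTransGen.total_of_right_unique hu
    (Relation.reflTransGen_swap.2 h) (Relation.reflTransGen_swap.2 h') with h₁ | h₁
  · exact (key hm' hm (Relation.reflTransGen_swap.1 h₁)).symm
  · exact key hm hm' (Relation.reflTransGen_swap.1 h₁)

theorem Reaches.of_arc {n m z : V} (hm : G.Arc n m) (h : G.Reaches m z) : G.Reaches n z :=
  Relation.ReflTransGen.head hm h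

theorem exists_movesAt_reaches {n : V} (hn : ∃ m, G.Arc n m) {z : G.Terminal}
    (h : G.Reaches n z.1) : ∃ m : G.MovesAt n, G.Reaches m.1 z.1 := by
  rcases Relation.ReflTransGen.cases_head h with h | ⟨m, hm, hmz⟩
  · obtain ⟨m, hm⟩ := hn
    exact absurd (h ▸ hm) (z.2 m)
  · exact ⟨⟨m, hm⟩, hmz⟩

open scoped Classical in
theorem sum_movesAt_ite_reaches [Finite V] {n : V} (hn : ∃ m, G.Arc n m) (z : G.Terminal)
    (y : ℝ) :
    ∑ m : G.MovesAt n, (if G.Reaches m.1 z.1 then y else 0) =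
      if G.Reaches n z.1 then y else 0 := by
  split_ifs with h
  · obtain ⟨m, hm⟩ := exists_movesAt_reaches hn h
    rw [Finset.sum_eq_single m, if_pos hm]
    · exact fun m' _ hne => if_neg fun h' => hne (Subtype.ext (eq_of_reaches_of_arc m'.2 m.2 h' hm))
    · simp
  · exact Finset.sum_eq_zero fun m _ => if_neg fun h' => h (h'.of_arc m.2)

end Tree

/-! ### The outcome of the stage game -/

section Outcome

variable [Finite V]

theorem outcomeFrom_of_decision (σ : G.Profile) {n : V} (h : ∃ m, G.Arc n m) :
    G.outcomeFrom σ n =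
      (σ (G.turn ⟨n, h⟩) ⟨⟨n, h⟩, rfl⟩).bind fun m => G.outcomeFrom σ m.1 := by
  rw [outcomeFrom, WellFounded.fix_eq, dif_pos h]

theorem outcomeFrom_of_terminal (σ : G.Profile) (z : G.Terminal) :
    G.outcomeFrom σ z.1 = PMF.pure z := by
  rw [outcomeFrom, WellFounded.fix_eq, dif_neg (by simpa using z.2)]
  rfl

theorem sum_bind_mul {α β : Type*} [Fintype α] [Fintype β] (p : PMF α) (q : α → PMF β)
    (F : β → ℝ≥0∞) : ∑ z, p.bind q z * F z = ∑ m, p m * ∑ z, q m z * F z := by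
  simp only [PMF.bind_apply, tsum_fintype, Finset.sum_mul, Finset.mul_sum, mul_assoc]
  exact Finset.sum_comm

theorem sum_toReal_bind_mul {α β : Type*} [Fintype α] [Fintype β] (p : PMF α) (q : α → PMF β)
    (f : β → ℝ) :
    ∑ z, (p.bind q z).toReal * f z = ∑ m, (p m).toReal * ∑ z, (q m z).toReal * f z := by
  simp only [PMF.bind_apply, tsum_fintype, Finset.mul_sum]
  rw [Finset.sum_comm]
  refine Finset.sum_congr rfl fun z _ => ?_
  rw [ENNReal.toReal_sum fun m _ => ENNReal.mul_ne_top (p.apply_ne_top m) ((q m).apply_ne_top z),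
    Finset.sum_mul]
  simp only [ENNReal.toReal_mul, mul_assoc]

theorem sum_coe_eq_one {α : Type*} [Fintype α] (p : PMF α) : ∑ a, p a = 1 := by
  rw [← tsum_fintype (L := .unconditional _), PMF.tsum_coe]

theorem sum_toReal_eq_one {α : Type*} [Fintype α] (p : PMF α) : ∑ a, (p a).toReal = 1 := by
  rw [← ENNReal.toReal_sum fun a _ => p.apply_ne_top a, sum_coe_eq_one, ENNReal.toReal_one]

theorem sum_pure_mul {α : Type*} [Fintype α] (a : α) (F : α → ℝ≥0∞) :
    ∑ z, PMF.pure a z * F z = F a := by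
  classical
  simp [PMF.pure_apply]

theorem sum_toReal_pure_mul {α : Type*} [Fintype α] (a : α) (f : α → ℝ) :
    ∑ z, (PMF.pure a z).toReal * f z = f a := by
  classical
  rw [Finset.sum_eq_single a] <;> simp +contextual [PMF.pure_apply]

theorem sum_outcomeFrom_mul_eq (σ : G.Profile) (n : V) (F : G.Terminal → ℝ≥0∞) (c : ℝ≥0∞)
    (hF : ∀ z : G.Terminal, G.Reaches n z.1 → F z = c) :
    ∑ z, G.outcomeFrom σ n z * F z = c := by
  induction n using G.wellFounded_swap_arc.induction with
  | _ n ih =>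
    by_cases h : ∃ m, G.Arc n m
    · rw [outcomeFrom_of_decision G σ h, sum_bind_mul,
        Finset.sum_congr rfl fun m _ => by
          rw [ih m.1 m.2 fun z hz => hF z (hz.of_arc m.2)],
        ← Finset.sum_mul, sum_coe_eq_one, one_mul]
    · let z : G.Terminal := ⟨n, fun m hm => h ⟨m, hm⟩⟩
      rw [show n = z.1 from rfl, outcomeFrom_of_terminal, sum_pure_mul]
      exact hF z Relation.ReflTransGen.refl

/-- A function of the outcome that is one off the subtree of the node `n`, and that depends only
on the move at `n` otherwise, has expectation at most one as soon as this holds for the choice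
made at `n`. -/
theorem sum_outcome_mul_le_one (σ : G.Profile) {n : V} (hn : ∃ m, G.Arc n m)
    (F : G.Terminal → ℝ≥0∞) (c : G.MovesAt n → ℝ≥0∞)
    (h₁ : ∀ z : G.Terminal, ¬ G.Reaches n z.1 → F z = 1)
    (h₂ : ∀ (m : G.MovesAt n) (z : G.Terminal), G.Reaches m.1 z.1 → F z = c m)
    (h₃ : ∑ m, σ (G.turn ⟨n, hn⟩) ⟨⟨n, hn⟩, rfl⟩ m * c m ≤ 1) :
    ∑ z, G.outcome σ z * F z ≤ 1 := by
  -- Nodes strictly below `n` are excluded: there `F` equals some `c m`, which may exceed one.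
  suffices H : ∀ r, ¬ Relation.TransGen G.Arc n r → ∑ z, G.outcomeFrom σ r z * F z ≤ 1 by
    refine H G.root fun h => ?_
    obtain ⟨b, -, hb⟩ := Relation.TransGen.tail'_iff.1 h
    exact G.not_arc_root b hb
  intro r
  induction r using G.wellFounded_swap_arc.induction with
  | _ r ih =>
    intro hr
    by_cases hrn : r = n
    · subst hrn
      rw [outcomeFrom_of_decision G σ hn, sum_bind_mul]
      refine le_of_eq_of_le (Finset.sum_congr rfl fun m _ => ?_) h₃
      rw [G.sum_outcomeFrom_mul_eq σ m.1 F (c m) (h₂ m)]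
    · by_cases h : ∃ m, G.Arc r m
      · rw [outcomeFrom_of_decision G σ h, sum_bind_mul]
        refine (Finset.sum_le_sum fun m _ => mul_le_mul_right (ih m.1 m.2 fun hm => ?_) _).trans ?_
        · obtain ⟨b, hb, hbm⟩ := Relation.TransGen.tail'_iff.1 hm
          obtain rfl := G.eq_of_arc hbm m.2
          rcases Relation.reflTransGen_iff_eq_or_transGen.1 hb with h | h
          · exact hrn h
          · exact hr h
        · simp only [mul_one, sum_coe_eq_one, le_refl]
      · let z : G.Terminal := ⟨r, fun m hm => h ⟨m, hm⟩⟩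
        rw [show r = z.1 from rfl, outcomeFrom_of_terminal, sum_pure_mul]
        refine (h₁ z fun hz => ?_).le
        rcases Relation.reflTransGen_iff_eq_or_transGen.1 hz with h | h
        · exact hrn h
        · exact hr h

end Outcome

/-! ### Backward induction -/

section BackwardInduction

variable [Finite V]

open scoped Classical in
/-- The value of the node `n` for the player `i` when the other players act against `i`. -/
def value (i : I) : V → ℝ :=
  G.wellFounded_swap_arc.fix fun n next =>
    if h : ∃ m, G.Arc n m then
      if G.turn ⟨n, h⟩ = i then ⨆ m : G.MovesAt n, next m.1 m.2
      else ⨅ m : G.MovesAt n, next m.1 m.2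
    else G.payoff i ⟨n, fun m hm => h ⟨m, hm⟩⟩

theorem value_of_turn_eq {i : I} {n : V} (h : ∃ m, G.Arc n m) (hi : G.turn ⟨n, h⟩ = i) :
    G.value i n = ⨆ m : G.MovesAt n, G.value i m.1 := by
  rw [value, WellFounded.fix_eq, dif_pos h, if_pos hi]

theorem value_of_turn_ne {i : I} {n : V} (h : ∃ m, G.Arc n m) (hi : G.turn ⟨n, h⟩ ≠ i) :
    G.value i n = ⨅ m : G.MovesAt n, G.value i m.1 := by
  rw [value, WellFounded.fix_eq, dif_pos h, if_neg hi]

theorem value_of_terminal (i : I) (z : G.Terminal) : G.value i z.1 = G.payoff i z := by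
  rw [value, WellFounded.fix_eq, dif_neg (by simpa using z.2)]
  rfl

theorem exists_abs_payoff_le (i : I) : ∃ K : ℝ, 0 ≤ K ∧ ∀ z : G.Terminal, |G.payoff i z| ≤ K :=
  ⟨∑ z : G.Terminal, |G.payoff i z|, Finset.sum_nonneg fun _ _ => abs_nonneg _, fun z =>
    Finset.single_le_sum (f := fun z : G.Terminal => |G.payoff i z|)
      (fun _ _ => abs_nonneg _) (Finset.mem_univ z)⟩

theorem value_le {i : I} {K : ℝ} (hK : ∀ z : G.Terminal, G.payoff i z ≤ K) (n : V) :
    G.value i n ≤ K := by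
  induction n using G.wellFounded_swap_arc.induction with
  | _ n ih =>
    by_cases h : ∃ m, G.Arc n m
    · obtain ⟨m, hm⟩ := h
      by_cases hi : G.turn ⟨n, m, hm⟩ = i
      · have : Nonempty (G.MovesAt n) := ⟨⟨m, hm⟩⟩
        rw [G.value_of_turn_eq _ hi]
        exact ciSup_le fun m => ih m.1 m.2
      · rw [G.value_of_turn_ne _ hi]
        exact (ciInf_le (Set.finite_range _).bddBelow ⟨m, hm⟩).trans (ih m hm)
    · rw [G.value_of_terminal i ⟨n, fun m hm => h ⟨m, hm⟩⟩]
      exact hK _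

/-- At nodes of `i` any mixture of successor values is at most their maximum, so nothing is required
of the strategy of `i`. -/
theorem sum_outcomeFrom_mul_le_value (i : I) (f : G.Terminal → ℝ)
    (hf : ∀ z : G.Terminal, f z = G.value i z.1) (τ : G.Profile)
    (hτ : ∀ (n : V) (h : ∃ m, G.Arc n m), G.turn ⟨n, h⟩ ≠ i →
      ∃ m : G.MovesAt n, G.value i m.1 ≤ G.value i n ∧
        τ (G.turn ⟨n, h⟩) ⟨⟨n, h⟩, rfl⟩ = PMF.pure m) (n : V) :
    ∑ z, (G.outcomeFrom τ n z).toReal * f z ≤ G.value i n := by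
  induction n using G.wellFounded_swap_arc.induction with
  | _ n ih =>
    by_cases h : ∃ m, G.Arc n m
    · rw [outcomeFrom_of_decision G τ h, sum_toReal_bind_mul]
      by_cases hi : G.turn ⟨n, h⟩ = i
      · rw [G.value_of_turn_eq h hi]
        calc _ ≤ ∑ m : G.MovesAt n, (τ (G.turn ⟨n, h⟩) ⟨⟨n, h⟩, rfl⟩ m).toReal *
              ⨆ m : G.MovesAt n, G.value i m.1 :=
              Finset.sum_le_sum fun m _ => mul_le_mul_of_nonneg_left
                ((ih m.1 m.2).trans (le_ciSup (f := fun m : G.MovesAt n => G.value i m.1)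
                  (Set.finite_range _).bddAbove m)) ENNReal.toReal_nonneg
          _ = _ := by rw [← Finset.sum_mul, sum_toReal_eq_one, one_mul]
      · obtain ⟨m, hm, hp⟩ := hτ n h hi
        rw [hp, sum_toReal_pure_mul]
        exact (ih m.1 m.2).trans hm
    · let z : G.Terminal := ⟨n, fun m hm => h ⟨m, hm⟩⟩
      rw [show n = z.1 from rfl, outcomeFrom_of_terminal, sum_toReal_pure_mul, hf]

theorem bddBelow_range_expectedPayoff {ι : Type*} (i : I) (τ : ι → G.Profile) :
    BddBelow (Set.range fun a => G.expectedPayoff i (τ a)) := by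
  obtain ⟨K, -, hK⟩ := G.exists_abs_payoff_le i
  refine ⟨-K, ?_⟩
  rintro _ ⟨a, rfl⟩
  calc -K = ∑ z, (G.outcome (τ a) z).toReal * -K := by
        rw [← Finset.sum_mul, sum_toReal_eq_one, one_mul]
    _ ≤ _ := Finset.sum_le_sum fun z _ =>
        mul_le_mul_of_nonneg_left (abs_le.1 (hK z)).1 ENNReal.toReal_nonneg

/-- Against every strategy of `i`, let the opponents always move to a successor of least value. The
reverse inequality is not needed. -/
theorem maxmin_le_value_root (i : I) : G.maxmin i ≤ G.value i G.root := by
  classical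
  have hmin : ∀ d : G.Decision, ∃ m : G.MovesAt d.1, ∀ m' : G.MovesAt d.1,
      G.value i m.1 ≤ G.value i m'.1 := fun d =>
    have : Nonempty (G.MovesAt d.1) := ⟨⟨_, d.2.choose_spec⟩⟩
    Finite.exists_min fun m : G.MovesAt d.1 => G.value i m.1
  choose b hb using hmin
  have : Nonempty (G.Strategy i) := ⟨G.uniformStrategy i⟩
  refine ciSup_le fun s => ?_
  refine ciInf_le_of_le (G.bddBelow_range_expectedPayoff i _) (fun j n => PMF.pure (b n.1)) ?_
  refine G.sum_outcomeFrom_mul_le_value i _ (fun z => (G.value_of_terminal i z).symm) _ ?_ _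
  intro n h hi
  refine ⟨b ⟨n, h⟩, ?_, ?_⟩
  · rw [G.value_of_turn_ne h hi]
    have : Nonempty (G.MovesAt n) := ⟨⟨_, h.choose_spec⟩⟩
    exact le_ciInf fun m => hb ⟨n, h⟩ m
  · rw [Function.update_of_ne hi]

end BackwardInduction

/-! ### Counting visits along a sequence -/

section Counting

open scoped Classical in
/-- The sum of the payoffs `f k` over the rounds `k < t` in which `P` holds. -/
def visitTotal (P : ℕ → Prop) (f : ℕ → ℝ) (t : ℕ) : ℝ :=
  ∑ k ∈ Finset.range t, if P k then f k else 0

/-- The number of rounds `k < t` in which `P` holds. -/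
def visitCount (P : ℕ → Prop) (t : ℕ) : ℝ := visitTotal P (fun _ => 1) t

theorem visitTotal_succ_of {P : ℕ → Prop} {t : ℕ} (h : P t) (f : ℕ → ℝ) :
    visitTotal P f (t + 1) = visitTotal P f t + f t := by
  rw [visitTotal, Finset.sum_range_succ, if_pos h, visitTotal]

theorem visitTotal_succ_of_not {P : ℕ → Prop} {t : ℕ} (h : ¬ P t) (f : ℕ → ℝ) :
    visitTotal P f (t + 1) = visitTotal P f t := by
  rw [visitTotal, Finset.sum_range_succ, if_neg h, add_zero, visitTotal]

theorem visitCount_succ_of {P : ℕ → Prop} {t : ℕ} (h : P t) :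
    visitCount P (t + 1) = visitCount P t + 1 := visitTotal_succ_of h _

theorem visitCount_succ_of_not {P : ℕ → Prop} {t : ℕ} (h : ¬ P t) :
    visitCount P (t + 1) = visitCount P t := visitTotal_succ_of_not h _

theorem visitCount_nonneg (P : ℕ → Prop) (t : ℕ) : 0 ≤ visitCount P t := by
  rw [visitCount, visitTotal]
  exact Finset.sum_nonneg fun _ _ => by split_ifs <;> simp

theorem visitCount_eq_zero_or_one_le (P : ℕ → Prop) (t : ℕ) :
    visitCount P t = 0 ∨ 1 ≤ visitCount P t := by
  classical
  have h : visitCount P t = ((Finset.range t).filter P).card := by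
    rw [visitCount, visitTotal, Finset.sum_boole]
  rw [h]
  rcases Nat.eq_zero_or_pos ((Finset.range t).filter P).card with h | h
  · left; rw [h, Nat.cast_zero]
  · right; exact_mod_cast h

theorem visitCount_mono {P Q : ℕ → Prop} (h : ∀ k, P k → Q k) (t : ℕ) :
    visitCount P t ≤ visitCount Q t := by
  rw [visitCount, visitCount, visitTotal, visitTotal]
  refine Finset.sum_le_sum fun k _ => ?_
  by_cases hP : P k
  · rw [if_pos hP, if_pos (h k hP)]
  · rw [if_neg hP]
    split_ifs <;> simp

theorem mul_visitCount_sub_le_visitTotal {P : ℕ → Prop} {f : ℕ → ℝ} {θ B : ℝ}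
    (hf : ∀ k, θ - f k ≤ B) (t : ℕ) :
    (θ - B) * visitCount P t ≤ visitTotal P f t := by
  rw [visitCount, visitTotal, visitTotal, Finset.mul_sum]
  refine Finset.sum_le_sum fun k _ => ?_
  split_ifs
  · linarith [hf k]
  · simp

/-- Suppose that the alternative `P₀` pays on average at least `θ`, up to a bounded error, and is
used in a positive proportion of the rounds in which `Q` holds. If the alternative `P` is used
only when its average is at least the one of `P₀`, except in the rounds in which `X` holds, then
its total payoff falls short of `θ` per round by a multiple of the number of these exceptions. -/
theorem exists_le_visitTotal_of_greedy {P P₀ Q X : ℕ → Prop} {f : ℕ → ℝ} {θ B C₀ C₁ a : ℝ}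
    (hB : 0 ≤ B) (ha : 0 < a) (hf : ∀ k, θ - f k ≤ B) (hPQ : ∀ k, P k → Q k)
    (h₀ : ∀ t, θ * visitCount P₀ t - C₀ ≤ visitTotal P₀ f t)
    (h₁ : ∀ t, a * visitCount Q t ≤ visitCount P₀ t + C₁)
    (hgreedy : ∀ t, P t → ¬ X t → 0 < visitCount P t → 0 < visitCount P₀ t →
      visitTotal P₀ f t / visitCount P₀ t ≤ visitTotal P f t / visitCount P t) :
    ∃ C, ∀ t, θ * visitCount P t - C - B * visitCount (fun k => P k ∧ X k) t ≤
      visitTotal P f t := by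
  have hC₀ : 0 ≤ C₀ := by simpa [visitCount, visitTotal] using h₀ 0
  have hC₁ : 0 ≤ C₁ := by simpa [visitCount, visitTotal] using h₁ 0
  -- The bound just before a greedy use of `P`. Such a round then loses at most `B`, which is the
  -- last term of the final constant; other uses of `P` are charged to the count of exceptions.
  have key : ∀ t, P t → ¬ X t →
      θ * visitCount P t - (C₀ * ((1 + C₁) / a) + B * (C₁ / a)) ≤ visitTotal P f t := by
    intro t hP hX
    have hQ := visitCount_mono hPQ t
    have hnn : 0 ≤ B * (C₁ / a) := by positivity
    have hnn' : 0 ≤ C₀ * ((1 + C₁) / a) := by positivity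
    -- While `P₀` is unused, `Q` and hence `P` has held at most `C₁ / a` times.
    rcases visitCount_eq_zero_or_one_le P₀ t with h | h
    · have h2 : visitCount P t ≤ C₁ / a := by
        rw [le_div_iff₀ ha]
        nlinarith [h₁ t]
      nlinarith [mul_visitCount_sub_le_visitTotal (P := P) hf t,
        mul_le_mul_of_nonneg_left h2 hB]
    · rcases visitCount_eq_zero_or_one_le P t with h' | h'
      · have := mul_visitCount_sub_le_visitTotal (P := P) hf t
        rw [h', mul_zero] at this ⊢
        linarith
      -- The average of `P₀` may miss `θ` by `C₀ / visitCount P₀ t`. Over the uses of `P` this adds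
      -- up to `C₀` times the present ratio, which is bounded because `visitCount P₀ t` is at least
      -- one.
      · have hr : visitCount P t / visitCount P₀ t ≤ (1 + C₁) / a := by
          rw [div_le_div_iff₀ (by linarith) ha]
          nlinarith [h₁ t]
        have hg := hgreedy t hP hX (by linarith) (by linarith)
        rw [le_div_iff₀ (by linarith : 0 < visitCount P t)] at hg
        refine le_trans ?_ hg
        have h3 : θ - C₀ / visitCount P₀ t ≤ visitTotal P₀ f t / visitCount P₀ t := by
          rw [le_div_iff₀ (by linarith), sub_mul, div_mul_cancel₀ _ (by linarith)]
          exact h₀ t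
        have h4 := mul_le_mul_of_nonneg_right h3 (visitCount_nonneg P t)
        have h5 := mul_le_mul_of_nonneg_left hr hC₀
        have h6 : C₀ / visitCount P₀ t * visitCount P t =
          C₀ * (visitCount P t / visitCount P₀ t) := by ring
        rw [sub_mul, h6] at h4
        linarith
  refine ⟨C₀ * ((1 + C₁) / a) + B * (C₁ / a) + B, fun t => ?_⟩
  have hC : 0 ≤ C₀ * ((1 + C₁) / a) + B * (C₁ / a) + B := by positivity
  induction t with
  | zero =>
    simp only [visitCount, visitTotal, Finset.range_zero, Finset.sum_empty, mul_zero]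
    linarith
  | succ t ih =>
    by_cases hP : P t
    · rw [visitCount_succ_of hP, visitTotal_succ_of hP]
      by_cases hX : X t
      · rw [visitCount_succ_of (P := fun k => P k ∧ X k) ⟨hP, hX⟩]
        linarith [hf t]
      · rw [visitCount_succ_of_not (P := fun k => P k ∧ X k) fun h => hX h.2]
        have := mul_nonneg hB (visitCount_nonneg (fun k => P k ∧ X k) t)
        linarith [hf t, key t hP hX]
    · rwa [visitCount_succ_of_not hP, visitTotal_succ_of_not hP,
        visitCount_succ_of_not (P := fun k => P k ∧ X k) fun h => hP h.1]

end Counting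

/-! ### Visits to the nodes of the game -/

section Visits

/-- The node `n` is reached in round `k + 1` of the infinite history `x`. -/
def Visits (x : ℕ → G.Terminal) (n : V) (k : ℕ) : Prop := G.Reaches n (x k).1

/-- The payoffs of the player `i` along an infinite history. -/
def payoffAlong (i : I) (x : ℕ → G.Terminal) (k : ℕ) : ℝ := G.payoff i (x k)

theorem visitTotal_visits_eq_sum [Finite V] {n : V} (hn : ∃ m, G.Arc n m) (x : ℕ → G.Terminal)
    (f : ℕ → ℝ) (t : ℕ) :
    visitTotal (G.Visits x n) f t = ∑ m : G.MovesAt n, visitTotal (G.Visits x m.1) f t := by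
  simp only [visitTotal]
  rw [Finset.sum_comm]
  refine Finset.sum_congr rfl fun k _ => ?_
  exact (sum_movesAt_ite_reaches hn (x k) (f k)).symm

theorem averaging_revise_eq {i : I} (v : G.Valuation i) (x : ℕ → G.Terminal) (t : ℕ)
    (m : G.MovesOf i) (h : 0 < visitCount (G.Visits x m.1) t) :
    (G.averaging i).revise v t (initialHistory x t) m =
      visitTotal (G.Visits x m.1) (G.payoffAlong i x) t / visitCount (G.Visits x m.1) t := by
  classical
  have htot : ∀ f : ℕ → ℝ, visitTotal (G.Visits x m.1) f t =
      ∑ l ∈ G.reachTimes (initialHistory x t) m.1, f l := by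
    intro f
    rw [visitTotal, Finset.sum_range, reachTimes, Finset.sum_filter]
    rfl
  have hcount : visitCount (G.Visits x m.1) t =
      ((G.reachTimes (initialHistory x t) m.1).card : ℝ) := by
    rw [visitCount, htot, Finset.sum_const, nsmul_eq_mul, mul_one]
  have hne : G.reachTimes (initialHistory x t) m.1 ≠ ∅ := by
    intro h0
    rw [hcount, h0] at h
    simp at h
  rw [hcount, htot]
  exact if_neg hne

end Visits

/-! ### Exploration -/

section Exploration

variable [Finite V]

theorem toReal_mix_apply {α : Type*} (δ : unitInterval) (p q : PMF α) (a : α) :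
    (mix δ p q a).toReal = (1 - δ) * (p a).toReal + δ * (q a).toReal := by
  have h : mix δ p q a = ENNReal.ofReal (1 - δ) * p a + ENNReal.ofReal δ * q a := rfl
  rw [h, ENNReal.toReal_add (ENNReal.mul_ne_top ENNReal.ofReal_ne_top (p.apply_ne_top a))
    (ENNReal.mul_ne_top ENNReal.ofReal_ne_top (q.apply_ne_top a)), ENNReal.toReal_mul,
    ENNReal.toReal_mul, ENNReal.toReal_ofReal (sub_nonneg.2 δ.2.2), ENNReal.toReal_ofReal δ.2.1]

theorem sum_mul_ofReal_le_one {α : Type*} [Fintype α] (p : PMF α) {c : α → ℝ}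
    (hc : ∀ a, 0 ≤ c a) (h : ∑ a, (p a).toReal * c a ≤ 1) :
    ∑ a, p a * ENNReal.ofReal (c a) ≤ 1 := by
  have : ∀ a, p a * ENNReal.ofReal (c a) = ENNReal.ofReal ((p a).toReal * c a) := fun a => by
    rw [ENNReal.ofReal_mul ENNReal.toReal_nonneg, ENNReal.ofReal_toReal (p.apply_ne_top a)]
  rw [Finset.sum_congr rfl fun a _ => this a, ← ENNReal.ofReal_sum_of_nonneg fun a _ =>
    mul_nonneg ENNReal.toReal_nonneg (hc a)]
  exact ENNReal.ofReal_le_one.2 h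

/-- If the increments `g` vanish off the subtree of a node `n` of player `i` and depend only on
the move at `n` otherwise, and if their exponentials have expectation at most one when that move
is drawn from the strategy of `i`, then their partial sums are almost surely bounded above. -/
theorem ae_exists_sum_le_of_decision (S : G.SuperProfile) {i : I} (n : G.DecisionOf i)
    (g : (t : ℕ) → G.History t → G.Terminal → ℝ)
    (c : (t : ℕ) → G.History t → G.MovesAt n.1.1 → ℝ)
    (h₁ : ∀ t h (z : G.Terminal), ¬ G.Reaches n.1.1 z.1 → g t h z = 0)
    (h₂ : ∀ t h (m : G.MovesAt n.1.1) (z : G.Terminal), G.Reaches m.1 z.1 → g t h z = c t h m)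
    (h₃ : ∀ t h, ∑ m, (S i t h n m).toReal * Real.exp (c t h m) ≤ 1) :
    ∀ᵐ x ∂(G.playMeasure S), ∃ C : ℝ, ∀ t,
      ∑ k ∈ Finset.range t, g k (initialHistory x k) (x k) ≤ C := by
  refine G.ae_exists_sum_le S g fun t h => ?_
  refine G.sum_outcome_mul_le_one (fun j => S j t h) n.1.2 _
    (fun m => ENNReal.ofReal (Real.exp (c t h m))) (fun z hz => ?_) (fun m z hz => ?_) ?_
  · rw [h₁ t h z hz, Real.exp_zero, ENNReal.ofReal_one]
  · rw [h₂ t h m z hz]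
  · obtain ⟨n, rfl⟩ := n
    exact sum_mul_ofReal_le_one _ (fun _ => (Real.exp_pos _).le) (h₃ t h)

/-- Almost surely, the proportion of the visits to a node in which a suboptimal move is made is at
most `2 * δ`, up to a bounded error. -/
theorem ae_exists_visitCount_suboptimal_le (S : G.SuperProfile) {i : I} (n : G.DecisionOf i)
    (δ : unitInterval) (w : (t : ℕ) → G.History t → G.Valuation i)
    (hS : ∀ t h, S i t h = G.exploratory i δ (w t h)) :
    ∀ᵐ x ∂(G.playMeasure S), ∃ C : ℝ, ∀ t,
      ∑ m : G.MovesAt n.1.1, visitCount (fun k => G.Visits x m.1 k ∧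
        m ∉ G.maximizers (w k (initialHistory x k)) n) t ≤
          2 * δ * visitCount (G.Visits x n.1.1) t + C := by
  classical
  let e (t : ℕ) (h : G.History t) (m : G.MovesAt n.1.1) : ℝ :=
    if m ∉ G.maximizers (w t h) n then 1 else 0
  have H := G.ae_exists_sum_le_of_decision S n
    (fun t h z => ∑ m : G.MovesAt n.1.1, if G.Reaches m.1 z.1 then e t h m - 2 * δ else 0)
    (fun t h m => e t h m - 2 * δ) ?_ ?_ ?_
  · filter_upwards [H] with x ⟨C, hC⟩
    refine ⟨C, fun t => ?_⟩
    have h1 := hC t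
    rw [Finset.sum_comm] at h1
    have h2 : ∀ m : G.MovesAt n.1.1, ∑ k ∈ Finset.range t,
        (if G.Reaches m.1 (x k).1 then e k (initialHistory x k) m - 2 * δ else 0) =
        visitCount (fun k => G.Visits x m.1 k ∧
          m ∉ G.maximizers (w k (initialHistory x k)) n) t -
          2 * δ * visitCount (G.Visits x m.1) t := by
      intro m
      rw [visitCount, visitCount, visitTotal, visitTotal, Finset.mul_sum,
        ← Finset.sum_sub_distrib]
      refine Finset.sum_congr rfl fun k _ => ?_
      by_cases hk : G.Reaches m.1 (x k).1
      · have hk' : G.Visits x m.1 k := hk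
        simp only [hk, hk', if_true, true_and, mul_one, e]
      · have hk' : ¬ G.Visits x m.1 k := hk
        simp only [hk, hk', if_false, false_and, mul_zero, sub_zero]
    rw [Finset.sum_congr rfl fun m _ => h2 m, Finset.sum_sub_distrib, ← Finset.mul_sum] at h1
    have h3 := G.visitTotal_visits_eq_sum n.1.2 x (fun _ => 1) t
    simp only [visitCount] at h1 ⊢
    rw [h3]
    linarith
  · intro t h z hz
    exact Finset.sum_eq_zero fun m _ => if_neg fun hm => hz (hm.of_arc m.2)
  · intro t h m z hz
    rw [Finset.sum_eq_single m, if_pos hz]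
    · exact fun m' _ hne => if_neg fun h' => hne (Subtype.ext (eq_of_reaches_of_arc m'.2 m.2 h' hz))
    · simp
  · intro t h
    have hδ := δ.2.1
    have hδ' := δ.2.2
    -- Only the uniform part of the mixture can pick a suboptimal move. The expectation is thus at
    -- most $e^{-2\delta}(1+\delta(e-1))$, and $e\le 3$ makes the rate $2\delta$ sufficient.
    have hle : ∀ m : G.MovesAt n.1.1, (S i t h n m).toReal * Real.exp (e t h m - 2 * δ) ≤
        (1 - δ) * Real.exp (-(2 * δ)) * (G.myopic i (w t h) n m).toReal +
          δ * (Real.exp 1 * Real.exp (-(2 * δ))) * (G.uniformStrategy i n m).toReal := by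
      intro m
      rw [hS, exploratory, toReal_mix_apply]
      have he1 : Real.exp (e t h m - 2 * δ) ≤ Real.exp 1 * Real.exp (-(2 * δ)) := by
        rw [← Real.exp_add]
        refine Real.exp_le_exp.2 ?_
        simp only [e]
        split_ifs <;> linarith
      have he2 : (G.myopic i (w t h) n m).toReal * Real.exp (e t h m - 2 * δ) =
          (G.myopic i (w t h) n m).toReal * Real.exp (-(2 * δ)) := by
        by_cases hm : m ∈ G.maximizers (w t h) n
        · simp [e, hm]
        · have : G.myopic i (w t h) n m = 0 :=
            PMF.uniformOfFinset_apply_of_notMem _ hm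
          simp [this]
      have hu : 0 ≤ (δ : ℝ) * (G.uniformStrategy i n m).toReal :=
        mul_nonneg hδ ENNReal.toReal_nonneg
      have := mul_le_mul_of_nonneg_left he1 hu
      calc _ = (1 - δ) * ((G.myopic i (w t h) n m).toReal * Real.exp (e t h m - 2 * δ)) +
            δ * (G.uniformStrategy i n m).toReal * Real.exp (e t h m - 2 * δ) := by ring
        _ ≤ _ := by rw [he2]; linarith
    refine (Finset.sum_le_sum fun m _ => hle m).trans ?_
    rw [Finset.sum_add_distrib, ← Finset.mul_sum, ← Finset.mul_sum, sum_toReal_eq_one,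
      sum_toReal_eq_one]
    have h1 : 1 + 2 * (δ : ℝ) ≤ Real.exp (2 * δ) := by
      linarith [Real.add_one_le_exp (2 * (δ : ℝ))]
    have h2 : Real.exp 1 ≤ 3 := Real.exp_one_lt_three.le
    have h3 : Real.exp (2 * δ) * Real.exp (-(2 * δ)) = 1 := by
      rw [← Real.exp_add, add_neg_cancel, Real.exp_zero]
    have h4 := Real.exp_pos (-(2 * (δ : ℝ)))
    have h5 : 1 - δ + δ * Real.exp 1 ≤ Real.exp (2 * δ) := by nlinarith
    nlinarith [mul_le_mul_of_nonneg_right h5 h4.le]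

/-- Almost surely, each move at a node is made in a positive proportion of the visits to the node,
up to a bounded error. -/
theorem ae_exists_mul_visitCount_le (S : G.SuperProfile) {i : I} (n : G.DecisionOf i)
    (m₀ : G.MovesAt n.1.1) (δ : unitInterval) (hδ : 0 < (δ : ℝ))
    (w : (t : ℕ) → G.History t → G.Valuation i)
    (hS : ∀ t h, S i t h = G.exploratory i δ (w t h)) :
    ∃ a : ℝ, 0 < a ∧ ∀ᵐ x ∂(G.playMeasure S), ∃ C : ℝ, ∀ t,
      a * visitCount (G.Visits x n.1.1) t ≤ visitCount (G.Visits x m₀.1) t + C := by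
  classical
  let u : ℝ := (G.uniformStrategy i n m₀).toReal
  have hu : 0 < u := by
    refine ENNReal.toReal_pos ?_ (PMF.apply_ne_top _ _)
    simp [uniformStrategy]
  have he : 0 < 1 - Real.exp (-1) := sub_pos.2 (by simp)
  -- If `m₀` has probability $q\ge\delta u$, the exponential of `a - e m` has mean
  -- $e^a(1-q(1-e^{-1}))\le e^a(1-a)\le 1$.
  let a : ℝ := δ * u * (1 - Real.exp (-1))
  have ha : 0 < a := by positivity
  refine ⟨a, ha, ?_⟩
  let e (m : G.MovesAt n.1.1) : ℝ := if m = m₀ then 1 else 0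
  have H := G.ae_exists_sum_le_of_decision S n
    (fun t h z => ∑ m : G.MovesAt n.1.1, if G.Reaches m.1 z.1 then a - e m else 0)
    (fun t h m => a - e m) ?_ ?_ ?_
  · filter_upwards [H] with x ⟨C, hC⟩
    refine ⟨C, fun t => ?_⟩
    have h1 := hC t
    rw [Finset.sum_comm] at h1
    have h2 : ∀ m : G.MovesAt n.1.1, ∑ k ∈ Finset.range t,
        (if G.Reaches m.1 (x k).1 then a - e m else 0) =
        (a - e m) * visitCount (G.Visits x m.1) t := by
      intro m
      rw [visitCount, visitTotal, Finset.mul_sum]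
      refine Finset.sum_congr rfl fun k _ => ?_
      rw [mul_ite, mul_one, mul_zero]
      rfl
    rw [Finset.sum_congr rfl fun m _ => h2 m] at h1
    simp only [sub_mul] at h1
    rw [Finset.sum_sub_distrib, ← Finset.mul_sum] at h1
    simp only [e, ite_mul, one_mul, zero_mul, Finset.sum_ite_eq', Finset.mem_univ, if_true] at h1
    have h3 := G.visitTotal_visits_eq_sum n.1.2 x (fun _ => 1) t
    simp only [visitCount] at h1 ⊢
    rw [h3]
    linarith
  · intro t h z hz
    exact Finset.sum_eq_zero fun m _ => if_neg fun hm => hz (hm.of_arc m.2)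
  · intro t h m z hz
    rw [Finset.sum_eq_single m, if_pos hz]
    · exact fun m' _ hne => if_neg fun h' => hne (Subtype.ext (eq_of_reaches_of_arc m'.2 m.2 h' hz))
    · simp
  · intro t h
    have hq : δ * u ≤ (S i t h n m₀).toReal := by
      rw [hS, exploratory, toReal_mix_apply]
      have := mul_nonneg (sub_nonneg.2 δ.2.2) (ENNReal.toReal_nonneg (a := G.myopic i (w t h) n m₀))
      linarith
    have hexp : ∀ m : G.MovesAt n.1.1, Real.exp (a - e m) =
        Real.exp a - (if m = m₀ then Real.exp a * (1 - Real.exp (-1)) else 0) := by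
      intro m
      simp only [e]
      split_ifs
      · rw [sub_eq_add_neg, Real.exp_add]; ring
      · simp
    simp only [hexp, mul_sub, mul_ite, mul_zero]
    rw [Finset.sum_sub_distrib, ← Finset.sum_mul, sum_toReal_eq_one, Finset.sum_ite_eq',
      if_pos (Finset.mem_univ _)]
    have h1 : 1 - a ≤ Real.exp (-a) := by linarith [Real.add_one_le_exp (-a)]
    have h2 : Real.exp a * Real.exp (-a) = 1 := by
      rw [← Real.exp_add, add_neg_cancel, Real.exp_zero]
    have h3 := Real.exp_pos a
    have h4 : a ≤ (S i t h n m₀).toReal * (1 - Real.exp (-1)) :=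
      mul_le_mul_of_nonneg_right hq he.le
    nlinarith [mul_le_mul_of_nonneg_left h1 h3.le, mul_le_mul_of_nonneg_left h4 h3.le]

end Exploration

/-! ### The averages at the nodes -/

section Averages

variable [Finite V]

/-- If at a node of player `i` each alternative is used in a positive proportion of the visits,
the alternatives that are not best according to their averages are seldom used, and the total
payoff through each alternative is at least its value, then the same holds for the node itself. -/
theorem exists_le_visitTotal_of_decision {i : I} (n : G.DecisionOf i) {K d : ℝ} {δ : unitInterval}
    (hK : 0 ≤ K) (hK' : ∀ z : G.Terminal, |G.payoff i z| ≤ K) (hd : 0 ≤ d)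
    (v : G.Valuation i) (x : ℕ → G.Terminal) (m₀ : G.MovesAt n.1.1)
    (hm₀ : G.value i n.1.1 ≤ G.value i m₀.1)
    (hC : ∃ C : ℝ, ∀ t, (G.value i m₀.1 - d) * visitCount (G.Visits x m₀.1) t - C ≤
      visitTotal (G.Visits x m₀.1) (G.payoffAlong i x) t)
    {a : ℝ} (ha : 0 < a)
    (hvisit : ∃ C : ℝ, ∀ t,
      a * visitCount (G.Visits x n.1.1) t ≤ visitCount (G.Visits x m₀.1) t + C)
    (hsub : ∃ C : ℝ, ∀ t, ∑ m : G.MovesAt n.1.1, visitCount (fun k => G.Visits x m.1 k ∧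
      m ∉ G.maximizers ((G.averaging i).revise v k (initialHistory x k)) n) t ≤
        2 * δ * visitCount (G.Visits x n.1.1) t + C) :
    ∃ C : ℝ, ∀ t,
      (G.value i n.1.1 - (d + 4 * K * δ)) * visitCount (G.Visits x n.1.1) t - C ≤
        visitTotal (G.Visits x n.1.1) (G.payoffAlong i x) t := by
  obtain ⟨C₀, hC₀⟩ := hC
  obtain ⟨C₁, hC₁⟩ := hvisit
  obtain ⟨C₂, hC₂⟩ := hsub
  have hmove : ∀ m : G.MovesAt n.1.1, ∃ C, ∀ t,
      (G.value i n.1.1 - d) * visitCount (G.Visits x m.1) t - C -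
        2 * K * visitCount (fun k => G.Visits x m.1 k ∧
          m ∉ G.maximizers ((G.averaging i).revise v k (initialHistory x k)) n) t ≤
      visitTotal (G.Visits x m.1) (G.payoffAlong i x) t := by
    intro m
    refine exists_le_visitTotal_of_greedy (P₀ := G.Visits x m₀.1) (Q := G.Visits x n.1.1)
      (C₀ := C₀) (C₁ := C₁) (a := a) (by positivity) ha (fun k => ?_)
      (fun k hk => Reaches.of_arc m.2 hk) (fun t => ?_) hC₁ ?_
    · have h1 := G.value_le (fun z => (abs_le.1 (hK' z)).2) n.1.1
      have h2 := (abs_le.1 (hK' (x k))).1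
      rw [payoffAlong]
      linarith
    · refine le_trans ?_ (hC₀ t)
      have := mul_le_mul_of_nonneg_right (sub_le_sub_right hm₀ d)
        (visitCount_nonneg (G.Visits x m₀.1) t)
      linarith
    · intro t _ hmax hpos hpos₀
      rw [not_not, maximizers, Finset.mem_filter] at hmax
      have h1 := hmax.2 m₀
      rw [Valuation.at, Valuation.at] at h1
      -- Both moves have been made before, so their valuations are true averages and the initial
      -- valuation has no influence.
      rwa [G.averaging_revise_eq v x t ⟨m.1, n, m.2⟩ hpos,
        G.averaging_revise_eq v x t ⟨m₀.1, n, m₀.2⟩ hpos₀] at h1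
  choose C hC using hmove
  refine ⟨∑ m, C m + 2 * K * C₂, fun t => ?_⟩
  have h1 := Finset.sum_le_sum fun (m : G.MovesAt n.1.1) (_ : m ∈ Finset.univ) => hC m t
  rw [← G.visitTotal_visits_eq_sum n.1.2, Finset.sum_sub_distrib, Finset.sum_sub_distrib,
    ← Finset.mul_sum, ← Finset.mul_sum] at h1
  simp only [visitCount] at h1 hC₂ ⊢
  rw [← G.visitTotal_visits_eq_sum n.1.2] at h1
  -- A loss of at most `2 * K` at rate `2 * δ` gives the term `4 * K * δ`.
  have h2 := mul_le_mul_of_nonneg_left (hC₂ t) (by positivity : 0 ≤ 2 * K)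
  linarith

/-- Almost surely, the total payoff of the rounds in which the node `n` is reached is at least the
value of `n` per round, up to a loss proportional to `δ` per round, and a bounded error. -/
theorem exists_ae_exists_le_visitTotal (i : I) (n : V) :
    ∃ c : ℝ, 0 ≤ c ∧ ∀ δ : unitInterval, 0 < (δ : ℝ) → ∀ (v : G.Valuation i) (S : G.SuperProfile),
      S i = G.valuationSuperStrategy (G.exploratory i δ) (G.averaging i) v →
      ∀ᵐ x ∂(G.playMeasure S), ∃ C : ℝ, ∀ t,
        (G.value i n - c * δ) * visitCount (G.Visits x n) t - C ≤
          visitTotal (G.Visits x n) (G.payoffAlong i x) t := by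
  obtain ⟨K, hK, hK'⟩ := G.exists_abs_payoff_le i
  induction n using G.wellFounded_swap_arc.induction with
  | _ n ih =>
    by_cases h : ∃ m, G.Arc n m
    · have ih' : ∀ m : G.MovesAt n, _ := fun m => ih m.1 m.2
      choose c hc hcS using ih'
      have hle : ∀ m, c m ≤ ∑ m, c m := fun m =>
        Finset.single_le_sum (fun m _ => hc m) (Finset.mem_univ m)
      have hsum : 0 ≤ ∑ m, c m := Finset.sum_nonneg fun m _ => hc m
      -- The sum dominates the constants of all successors; `4 * K` pays for exploration at a node
      -- of `i` and is slack at other nodes. It is fixed before `δ`, `v` and `S`, whereas `a` and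
      -- the additive errors need not be uniform.
      refine ⟨∑ m, c m + 4 * K, by positivity, fun δ hδ v S hS => ?_⟩
      have hall := ae_all_iff.2 fun m => hcS m δ hδ v S hS
      have hmove : ∀ᵐ x ∂(G.playMeasure S), ∀ m : G.MovesAt n, ∃ C : ℝ, ∀ t,
          (G.value i m.1 - (∑ m, c m) * δ) * visitCount (G.Visits x m.1) t - C ≤
            visitTotal (G.Visits x m.1) (G.payoffAlong i x) t := by
        filter_upwards [hall] with x hx m
        obtain ⟨C, hC⟩ := hx m
        refine ⟨C, fun t => le_trans ?_ (hC t)⟩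
        have h1 := mul_le_mul_of_nonneg_right (hle m) hδ.le
        have := mul_le_mul_of_nonneg_right (sub_le_sub_left h1 (G.value i m.1))
          (visitCount_nonneg (G.Visits x m.1) t)
        linarith
      by_cases hi : G.turn ⟨n, h⟩ = i
      · let d : G.DecisionOf i := ⟨⟨n, h⟩, hi⟩
        have : Nonempty (G.MovesAt n) := ⟨⟨_, h.choose_spec⟩⟩
        obtain ⟨m₀, hm₀⟩ := exists_eq_ciSup_of_finite (f := fun m : G.MovesAt n => G.value i m.1)
        have hS' : ∀ t h, S i t h = G.exploratory i δ ((G.averaging i).revise v t h) :=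
          fun t h => by rw [hS]; rfl
        obtain ⟨a, ha, hvisit⟩ := G.ae_exists_mul_visitCount_le S d m₀ δ hδ _ hS'
        filter_upwards [hmove, hvisit, G.ae_exists_visitCount_suboptimal_le S d δ _ hS']
          with x hx hxv hxs
        obtain ⟨C, hC⟩ := G.exists_le_visitTotal_of_decision d hK hK'
          (mul_nonneg hsum hδ.le) v x m₀ ((G.value_of_turn_eq h hi).trans hm₀.symm).le (hx m₀)
          ha hxv hxs
        refine ⟨C, fun t => le_of_eq_of_le ?_ (hC t)⟩
        simp only [d]
        ring
      · filter_upwards [hmove] with x hx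
        choose C hC using hx
        refine ⟨∑ m, C m, fun t => ?_⟩
        rw [G.visitTotal_visits_eq_sum h, visitCount, G.visitTotal_visits_eq_sum h,
          Finset.mul_sum, ← Finset.sum_sub_distrib]
        refine Finset.sum_le_sum fun m _ => le_trans ?_ (hC m t)
        have h1 : G.value i n ≤ G.value i m.1 := by
          rw [G.value_of_turn_ne h hi]
          exact ciInf_le (Set.finite_range _).bddBelow m
        have h2 : 0 ≤ K * δ := mul_nonneg hK hδ.le
        have h3 : G.value i n - (∑ m, c m + 4 * K) * δ ≤ G.value i m.1 - (∑ m, c m) * δ := by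
          linarith
        have := mul_le_mul_of_nonneg_right h3 (visitCount_nonneg (G.Visits x m.1) t)
        exact sub_le_sub_right this _
    · refine ⟨0, le_rfl, fun δ _ v S _ => ae_of_all _ fun x => ⟨0, fun t => ?_⟩⟩
      let z : G.Terminal := ⟨n, fun m hm => h ⟨m, hm⟩⟩
      rw [visitCount, visitTotal, visitTotal, zero_mul, sub_zero, sub_zero, Finset.mul_sum]
      refine Finset.sum_le_sum fun k _ => ?_
      by_cases hk : G.Visits x n k
      · rw [if_pos hk, if_pos hk, mul_one]
        rcases Relation.ReflTransGen.cases_head hk with hz | ⟨m, hm, -⟩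
        · have hz' : x k = z := Subtype.ext hz.symm
          rw [payoffAlong, hz', show n = z.1 from rfl, value_of_terminal]
        · exact absurd ⟨m, hm⟩ h
      · rw [if_neg hk, if_neg hk, mul_zero]

end Averages

/-! ### From linear lower bounds to the lower limit -/

theorem lt_liminf_of_mul_sub_le_sum {f : ℕ → ℝ} {r θ K C : ℝ} (hr : r < θ)
    (hf : ∀ k, |f k| ≤ K) (h : ∀ t : ℕ, θ * t - C ≤ ∑ l ∈ Finset.range t, f l) :
    r < liminf (fun t : ℕ => (1 / (t : ℝ)) * ∑ l ∈ Finset.range t, f l) atTop := by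
  have hlim : Tendsto (fun t : ℕ => θ - C / (t : ℝ)) atTop (𝓝 (θ - 0)) :=
    tendsto_const_nhds.sub (tendsto_const_div_atTop_nhds_zero_nat C)
  rw [sub_zero] at hlim
  obtain ⟨s, hrs, hsθ⟩ := exists_between hr
  refine hrs.trans_le (le_liminf_of_le ?_ ?_)
  -- The real `liminf` is a conditional supremum, so the averages must also be bounded above.
  · refine IsBoundedUnder.isCoboundedUnder_ge ⟨K, ?_⟩
    rw [eventually_map]
    filter_upwards [eventually_gt_atTop 0] with t ht
    have ht' : (0 : ℝ) < t := Nat.cast_pos.2 ht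
    rw [one_div, inv_mul_le_iff₀ ht']
    calc _ ≤ ∑ l ∈ Finset.range t, K := Finset.sum_le_sum fun k _ => (abs_le.1 (hf k)).2
      _ = _ := by rw [Finset.sum_const, Finset.card_range, nsmul_eq_mul]
  · filter_upwards [hlim.eventually (eventually_gt_nhds hsθ), eventually_gt_atTop 0] with t hs ht
    have ht' : (0 : ℝ) < t := Nat.cast_pos.2 ht
    refine hs.le.trans ?_
    rw [one_div, ← div_eq_inv_mul, le_div_iff₀ ht', sub_mul, div_mul_cancel₀ _ ht'.ne']
    exact h t

end

end ExtensiveGame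

theorem theorem3 {I V : Type*} [Finite I] [Finite V] (G : ExtensiveGame I V) (i : I)
    (ε : ℝ) (hε : 0 < ε) :
    ∃ δ₀ : ℝ, 0 < δ₀ ∧ ∀ δ : unitInterval, 0 < (δ : ℝ) → (δ : ℝ) < δ₀ →
      ∀ (v : G.Valuation i) (S : G.SuperProfile),
        S i = G.valuationSuperStrategy (G.exploratory i δ) (G.averaging i) v →
        ∀ᵐ h ∂(G.playMeasure S),
          G.maxmin i - ε <
            liminf (fun t : ℕ => (1 / (t : ℝ)) * ∑ l ∈ Finset.range t, G.payoff i (h l)) atTop := by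
  obtain ⟨c, hc, hcS⟩ := G.exists_ae_exists_le_visitTotal i G.root
  obtain ⟨K, -, hK⟩ := G.exists_abs_payoff_le i
  -- This ensures `c * δ < ε`; adding one covers `c = 0`.
  refine ⟨ε / (c + 1), by positivity, fun δ hδ hδ' v S hS => ?_⟩
  filter_upwards [hcS δ hδ v S hS] with x ⟨C, hC⟩
  have htot : ∀ (f : ℕ → ℝ) (t : ℕ), ExtensiveGame.visitTotal (G.Visits x G.root) f t =
      ∑ l ∈ Finset.range t, f l := fun f t =>
    Finset.sum_congr rfl fun k _ => if_pos (G.reach_root _)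
  refine ExtensiveGame.lt_liminf_of_mul_sub_le_sum (f := G.payoffAlong i x)
    (θ := G.value i G.root - c * δ) (K := K) (C := C) ?_ (fun k => hK (x k)) fun t => ?_
  · have h1 := G.maxmin_le_value_root i
    rw [lt_div_iff₀ (by positivity)] at hδ'
    linarith
  · have := hC t
    rwa [ExtensiveGame.visitCount, htot, htot, Finset.sum_const, Finset.card_range, nsmul_eq_mul,
      mul_one] at this
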